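/- A symmetric probability measure $\mu$ on $\mathbb{R}$ with finite moments of all orders is said to have Jacobi sequence $\{\omega_n\}_{n\ge 1}$, $\omega_n>0$, if its monic orthogonal polynomials $P_0,P_1,\dots$ ($\deg P_n=n$) satisfy $xP_n(x)=P_{n+1}(x)+\omega_nP_{n-1}(x)$ for all $n\ge 0$, where $P_{-1}=0$. It is uniquely determined by its moments if every probability measure $\nu$ on $\mathbb{R}$ with finite moments $\int x^n\,d\nu=\int x^n\,d\mu$ for all $n\ge 0$ equals $\mu$. \textbf{Theorem.} Let $p>0$ be a real number. There is a symmetric probability measure on $\mathbb{R}$ with Jacobi sequence $\{n^p\}_{n\ge 1}$. Every such measure is uniquely determined by its moments if $p\le 2$, and none is if $p>2$. Moreover, there is exactly one symmetric probability measure with Jacobi sequence $\{n^p\}_{n\ge1}$ if and only if $p\le 2$. For $p=2$ this measure is the hyperbolic secant distribution $\dfrac{dx}{e^{\pi x/2}+e^{-\pi x/2}}$: it is a symmetric probability measure with Jacobi sequence $\{n^2\}_{n\ge1}$, and it is uniquely determined by its moments. -/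

import Mathlib

open MeasureTheory Polynomial

/-- All moments of the measure `μ` on the real line are finite. -/
def FiniteMoments (μ : Measure ℝ) : Prop :=
  ∀ n : ℕ, Integrable (fun x : ℝ => x ^ n) μ

/-- `P` is the sequence of monic orthogonal polynomials of `μ`: `P n` is monic of degree `n`, and
different members are orthogonal in `L²(μ)`. -/
structure IsMonicOrthogonal (μ : Measure ℝ) (P : ℕ → ℝ[X]) : Prop where
  monic : ∀ n, (P n).Monic
  natDegree_eq : ∀ n, (P n).natDegree = n
  orthogonal : ∀ m n, m ≠ n → ∫ x, (P m).eval x * (P n).eval x ∂μ = 0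

/-- `α` and `ω` (both indexed from `1`; the values at `0` are not used) are the Jacobi sequences
of `μ`: the monic orthogonal polynomials of `μ` satisfy
`x P_n = P_{n+1} + α_{n+1} P_n + ω_n P_{n-1}` for all `n ≥ 0`, with `P_{-1} = 0`. -/
def HasJacobiSequences (μ : Measure ℝ) (α ω : ℕ → ℝ) : Prop :=
  FiniteMoments μ ∧
  ∃ P : ℕ → ℝ[X], IsMonicOrthogonal μ P ∧
    X * P 0 = P 1 + C (α 1) * P 0 ∧
    ∀ n : ℕ, X * P (n + 1) = P (n + 2) + C (α (n + 2)) * P (n + 1) + C (ω (n + 1)) * P n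

/-- `μ` is a symmetric probability measure on the real line with Jacobi sequence
`ω 1, ω 2, …` (the other Jacobi sequence `α` of a symmetric measure is zero). -/
structure IsSymmetricWithJacobi (μ : Measure ℝ) (ω : ℕ → ℝ) : Prop where
  isProbabilityMeasure : IsProbabilityMeasure μ
  isNegInvariant : μ.IsNegInvariant
  hasJacobiSequences : HasJacobiSequences μ (fun _ => 0) ω

/-- The probability measure `μ` is uniquely determined by its moments, among all probability
measures on the real line whose moments are finite. -/
def IsMomentDeterminate (μ : Measure ℝ) : Prop :=
  ∀ ν : Measure ℝ, IsProbabilityMeasure ν → FiniteMoments ν →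
    (∀ n : ℕ, ∫ x, x ^ n ∂ν = ∫ x, x ^ n ∂μ) → ν = μ

/-- The hyperbolic secant distribution `dx / (e^{πx/2} + e^{-πx/2})`. -/
noncomputable def hyperbolicSecant : Measure ℝ :=
  volume.withDensity fun x : ℝ =>
    ENNReal.ofReal (1 / (Real.exp (Real.pi * x / 2) + Real.exp (-(Real.pi * x / 2))))

/-! Having Jacobi sequence `ω` amounts to `∫ P_{n+1} = 0` for all `n` (`isSymmetricWithJacobi_iff`),
so `ω` fixes all moments. If `ω n ≤ n ^ 2`, these are at most `2 ^ n * n!` (`jacobiMoment_bound`);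
exponential moments then exist near `0`, and analytic continuation to the imaginary axis identifies
the characteristic function.

Existence comes from finite Jacobi matrices with off-diagonal entries `b n = √(ω n)`: their spectral
measures at the first basis vector have the right moments up to the truncation order, and a weak
limit, symmetrized, has all of them.

For `p > 2` the parity of the matrix size matters. In odd size there is a kernel vector, which
forces an atom at `0`; in even size the first basis vector is `T u`, which bounds the mass near `0`.
The squared entries of both vectors are `O(n ^ (-p/2))`, hence summable, so both effects survive in
the limit and give two solutions that differ on `{0}`.

For `p = 2`, the secant law has `∫ P_n e^{sx} = n! sin^n s / cos^{n+1} s`, which vanishes at `s = 0`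
for `n ≥ 1`. -/

/-! ### Orthogonal polynomials and the moments they determine -/

/-- The monic polynomials satisfying `x P_n = P_{n+1} + ω_n P_{n-1}`. -/
noncomputable def jacobiPoly (ω : ℕ → ℝ) : ℕ → ℝ[X]
  | 0 => 1
  | 1 => X
  | n + 2 => X * jacobiPoly ω (n + 1) - C (ω (n + 1)) * jacobiPoly ω n

theorem jacobiPoly_monic_natDegree (ω : ℕ → ℝ) (n : ℕ) :
    (jacobiPoly ω n).Monic ∧ (jacobiPoly ω n).natDegree = n := by
  induction n using Nat.strong_induction_on with
  | _ n ih =>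
    match n with
    | 0 => simp [jacobiPoly]
    | 1 => simp [jacobiPoly, monic_X]
    | n + 2 =>
      obtain ⟨h1, h2⟩ := ih (n + 1) (by omega)
      obtain ⟨h3, h4⟩ := ih n (by omega)
      have hm : (X * jacobiPoly ω (n + 1)).Monic := monic_X.mul h1
      have hd : (X * jacobiPoly ω (n + 1)).natDegree = n + 2 := by
        rw [natDegree_X_mul h1.ne_zero, h2]
      have hlt : (C (ω (n + 1)) * jacobiPoly ω n).degree < (X * jacobiPoly ω (n + 1)).degree := by
        apply degree_lt_degree
        rw [hd]
        calc _ ≤ (jacobiPoly ω n).natDegree := natDegree_C_mul_le _ _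
          _ < n + 2 := by omega
      exact ⟨hm.sub_of_left hlt, (natDegree_sub_eq_left_of_natDegree_lt
        (by rw [hd]; exact (natDegree_C_mul_le _ _).trans_lt (by omega))).trans hd⟩

theorem X_mul_jacobiPoly (ω : ℕ → ℝ) (n : ℕ) :
    X * jacobiPoly ω (n + 1) = jacobiPoly ω (n + 2) + C (ω (n + 1)) * jacobiPoly ω n := by
  simp [jacobiPoly]

theorem FiniteMoments.integrable_eval {μ : Measure ℝ} (h : FiniteMoments μ) (q : ℝ[X]) :
    Integrable (fun x => q.eval x) μ := by
  simp_rw [eval_eq_sum_range]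
  exact integrable_finsetSum _ fun i _ => (h i).const_mul _

/-- The mixed moments `∫ x ^ n P_k` of a measure with Jacobi sequence `ω`. -/
def jacobiMoment (ω : ℕ → ℝ) : ℕ → ℕ → ℝ
  | 0, 0 => 1
  | 0, _ + 1 => 0
  | n + 1, 0 => jacobiMoment ω n 1
  | n + 1, k + 1 => jacobiMoment ω n (k + 2) + ω (k + 1) * jacobiMoment ω n k

/-- The recursion lowers `n` by one and moves `k` by one, so the parity of `n + k` is preserved.
This is what makes symmetrization harmless to the moments. -/
theorem jacobiMoment_eq_zero_of_odd (ω : ℕ → ℝ) (n : ℕ) :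
    ∀ k, Odd (n + k) → jacobiMoment ω n k = 0 := by
  induction n with
  | zero => rintro (_ | k) h <;> simp_all [jacobiMoment]
  | succ n ih =>
    rintro (_ | k) h
    · simpa [jacobiMoment] using ih 1 (by simpa using h)
    · rw [jacobiMoment, ih (k + 2) (by grind), ih k (by grind)]
      simp

/-- All `k` are treated together so that the induction closes: since `(k+1)^2 ≤ (n+k+2)(n+k+1)`,
both terms of the recursion are at most `2 ^ n * (n+k+2)!`, and their sum costs one factor `2`. -/
theorem jacobiMoment_bound {ω : ℕ → ℝ} (h0 : ∀ k, 0 ≤ ω k) (h : ∀ k, ω k ≤ (k : ℝ) ^ 2) (n : ℕ) :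
    ∀ k, 0 ≤ jacobiMoment ω n k ∧ jacobiMoment ω n k ≤ 2 ^ n * (n + k).factorial := by
  induction n with
  | zero =>
    rintro (_ | k)
    · simp [jacobiMoment]
    · simp [jacobiMoment]
  | succ n ih =>
    rintro (_ | k)
    · obtain ⟨h1, h2⟩ := ih 1
      refine ⟨h1, h2.trans ?_⟩
      rw [add_zero, pow_succ]
      have : (0 : ℝ) ≤ 2 ^ n * (n + 1).factorial := by positivity
      linarith
    · obtain ⟨h1, h2⟩ := ih (k + 2)
      obtain ⟨h3, h4⟩ := ih k
      refine ⟨add_nonneg h1 (mul_nonneg (h0 _) h3), ?_⟩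
      have h5 : ω (k + 1) * jacobiMoment ω n k ≤
          ((k + 1 : ℕ) : ℝ) ^ 2 * (2 ^ n * (n + k).factorial) :=
        mul_le_mul (h _) h4 h3 (by positivity)
      have h6 : ((k + 1 : ℕ) : ℝ) ^ 2 * (2 ^ n * (n + k).factorial) ≤
          2 ^ n * (n + (k + 2)).factorial := by
        have e : (n + (k + 2)).factorial = (n + k + 2) * ((n + k + 1) * (n + k).factorial) := by
          rw [← Nat.factorial_succ, ← Nat.factorial_succ]; rfl
        rw [e]
        have : (k + 1) ^ 2 ≤ (n + k + 2) * (n + k + 1) := by nlinarith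
        have h7 : (((k + 1) ^ 2 : ℕ) : ℝ) ≤ (((n + k + 2) * (n + k + 1) : ℕ) : ℝ) :=
          Nat.cast_le.2 this
        push_cast at h7 ⊢
        have h8 := mul_le_mul_of_nonneg_right h7
          (by positivity : (0 : ℝ) ≤ 2 ^ n * (n + k).factorial)
        linarith
      have e2 : n + 1 + (k + 1) = n + (k + 2) := by ring
      rw [jacobiMoment, e2, pow_succ]
      linarith

/-- The cutoff `N` is there for quadrature measures, for which only finitely many of the integrals
vanish. The recursion never increases `n + k`. -/
theorem integral_pow_mul_jacobiPoly {μ : Measure ℝ} [IsProbabilityMeasure μ] {ω : ℕ → ℝ} {N : ℕ}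
    (h : FiniteMoments μ) (hP : ∀ n < N, ∫ x, (jacobiPoly ω (n + 1)).eval x ∂μ = 0) (n : ℕ) :
    ∀ k, n + k ≤ N → ∫ x, x ^ n * (jacobiPoly ω k).eval x ∂μ = jacobiMoment ω n k := by
  have hint (n k : ℕ) : Integrable (fun x => x ^ n * (jacobiPoly ω k).eval x) μ :=
    (h.integrable_eval (X ^ n * jacobiPoly ω k)).congr (.of_forall fun x => by simp)
  induction n with
  | zero =>
    rintro (_ | k) hk
    · simp [jacobiMoment, jacobiPoly]
    · simpa [jacobiMoment] using hP k (by omega)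
  | succ n ih =>
    rintro (_ | k) hk
    · rw [jacobiMoment, ← ih 1 (by omega)]
      simp [jacobiPoly, pow_succ]
    · rw [jacobiMoment, ← ih (k + 2) (by omega), ← ih k (by omega), ← integral_const_mul, ← integral_add]
      · congr 1 with x
        have := congrArg (eval x) (X_mul_jacobiPoly ω k)
        simp only [eval_mul, eval_add, eval_X, eval_C] at this
        rw [pow_succ, mul_assoc, this]
        ring
      · exact hint n (k + 2)
      · exact (hint n k).const_mul _

theorem integral_pow_eq_jacobiMoment {μ : Measure ℝ} [IsProbabilityMeasure μ] {ω : ℕ → ℝ} {n : ℕ}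
    (h : FiniteMoments μ) (hP : ∀ k < n, ∫ x, (jacobiPoly ω (k + 1)).eval x ∂μ = 0) :
    ∫ x, x ^ n ∂μ = jacobiMoment ω n 0 := by
  simpa [jacobiPoly] using integral_pow_mul_jacobiPoly h hP n 0

theorem integral_eval_eq_of_moments {μ ν : Measure ℝ} (hμ : FiniteMoments μ)
    (hν : FiniteMoments ν) (q : ℝ[X])
    (h : ∀ n ≤ q.natDegree, ∫ x, x ^ n ∂μ = ∫ x, x ^ n ∂ν) :
    ∫ x, q.eval x ∂μ = ∫ x, q.eval x ∂ν := by
  simp_rw [eval_eq_sum_range]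
  rw [integral_finsetSum _ fun i _ => (hμ i).const_mul _,
    integral_finsetSum _ fun i _ => (hν i).const_mul _]
  simp_rw [integral_const_mul]
  exact Finset.sum_congr rfl fun i hi => by rw [h i (Finset.mem_range_succ_iff.1 hi)]

/-- Multiplication by `x` is symmetric in `L²(μ)`: moving it from one factor to the other and
applying the recurrence on both sides reduces `m` until only `∫ P_n` is left. -/
theorem integral_jacobiPoly_mul_eq_zero {μ : Measure ℝ} {ω : ℕ → ℝ} (h : FiniteMoments μ)
    (hP : ∀ n, ∫ x, (jacobiPoly ω (n + 1)).eval x ∂μ = 0) (m : ℕ) :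
    ∀ n, m < n → ∫ x, (jacobiPoly ω m).eval x * (jacobiPoly ω n).eval x ∂μ = 0 := by
  have hint (q r : ℝ[X]) : Integrable (fun x => q.eval x * r.eval x) μ := by
    simpa using h.integrable_eval (q * r)
  have hX (q r : ℝ[X]) : ∫ x, (X * q).eval x * r.eval x ∂μ =
      ∫ x, q.eval x * (X * r).eval x ∂μ := by
    congr 1 with x
    simp only [eval_mul, eval_X]
    ring
  have hr (q : ℝ[X]) (n : ℕ) : ∫ x, q.eval x * (X * jacobiPoly ω (n + 1)).eval x ∂μ =
      ∫ x, q.eval x * (jacobiPoly ω (n + 2)).eval x ∂μ +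
        ω (n + 1) * ∫ x, q.eval x * (jacobiPoly ω n).eval x ∂μ := by
    rw [← integral_const_mul, ← integral_add (hint _ _) ((hint _ _).const_mul _)]
    congr 1 with x
    rw [X_mul_jacobiPoly]
    simp only [eval_mul, eval_add, eval_C]
    ring
  induction m using Nat.strong_induction_on with
  | _ m ih =>
    match m with
    | 0 =>
      intro n hn
      obtain ⟨n, rfl⟩ := Nat.exists_eq_succ_of_ne_zero hn.ne'
      simpa [jacobiPoly] using hP n
    | 1 =>
      intro n hn
      obtain ⟨n, rfl⟩ := Nat.exists_eq_add_of_lt hn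
      have := hr 1 (1 + n)
      have e1 := ih 0 (by omega) (1 + n + 2) (by omega)
      have e2 := ih 0 (by omega) (1 + n) (by omega)
      simp only [jacobiPoly, eval_one, one_mul] at e1 e2 this ⊢
      simp only [e1, e2, eval_mul, eval_X] at this ⊢
      simpa using this
    | m + 2 =>
      intro n hn
      obtain ⟨n, rfl⟩ : ∃ k, n = k + 1 := ⟨n - 1, by omega⟩
      have e1 := hr (jacobiPoly ω (m + 1)) n
      rw [ih (m + 1) (by omega) (n + 2) (by omega), ih (m + 1) (by omega) n (by omega), ← hX] at e1
      have e2 : ∫ x, (X * jacobiPoly ω (m + 1)).eval x * (jacobiPoly ω (n + 1)).eval x ∂μ =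
          ∫ x, (jacobiPoly ω (m + 2)).eval x * (jacobiPoly ω (n + 1)).eval x ∂μ +
          ω (m + 1) * ∫ x, (jacobiPoly ω m).eval x * (jacobiPoly ω (n + 1)).eval x ∂μ := by
        rw [← integral_const_mul, ← integral_add (hint _ _) ((hint _ _).const_mul _)]
        congr 1 with x
        rw [X_mul_jacobiPoly]
        simp only [eval_mul, eval_add, eval_C]
        ring
      rw [e2, ih m (by omega) (n + 1) (by omega)] at e1
      simpa using e1

theorem isSymmetricWithJacobi_iff {μ : Measure ℝ} {ω : ℕ → ℝ} :
    IsSymmetricWithJacobi μ ω ↔ IsProbabilityMeasure μ ∧ μ.IsNegInvariant ∧ FiniteMoments μ ∧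
      ∀ n, ∫ x, (jacobiPoly ω (n + 1)).eval x ∂μ = 0 := by
  constructor
  · rintro ⟨h1, h2, h3, P, hP, hP0, hPs⟩
    have h0 : P 0 = 1 := (hP.monic 0).natDegree_eq_zero.1 (hP.natDegree_eq 0)
    have h1' : P 1 = X := by simpa [h0] using hP0.symm
    have key (n : ℕ) : P n = jacobiPoly ω n := by
      induction n using Nat.strong_induction_on with
      | _ n ih =>
        match n with
        | 0 => simpa [jacobiPoly] using h0
        | 1 => simpa [jacobiPoly] using h1'
        | n + 2 =>
          have := hPs n
          rw [jacobiPoly, ← ih (n + 1) (by omega), ← ih n (by omega), this]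
          simp
    refine ⟨h1, h2, h3, fun n => ?_⟩
    simpa [h0, key] using hP.orthogonal 0 (n + 1) (by omega)
  · rintro ⟨h1, h2, h3, h4⟩
    refine ⟨h1, h2, h3, jacobiPoly ω, ⟨fun n => (jacobiPoly_monic_natDegree ω n).1,
      fun n => (jacobiPoly_monic_natDegree ω n).2, fun m n hmn => ?_⟩, by simp [jacobiPoly],
      fun n => by simp [jacobiPoly]⟩
    rcases hmn.lt_or_gt with h | h
    · exact integral_jacobiPoly_mul_eq_zero h3 h4 m n h
    · simpa [mul_comm] using integral_jacobiPoly_mul_eq_zero h3 h4 n m h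

theorem IsSymmetricWithJacobi.integral_pow {μ : Measure ℝ} {ω : ℕ → ℝ}
    (h : IsSymmetricWithJacobi μ ω) (n : ℕ) : ∫ x, x ^ n ∂μ = jacobiMoment ω n 0 := by
  obtain ⟨h1, -, h3, h4⟩ := isSymmetricWithJacobi_iff.1 h
  exact integral_pow_eq_jacobiMoment h3 fun k _ => h4 k

/-! ### Determinacy from factorial moment growth -/

/-- The series of `cosh` has only nonnegative terms, so it may be integrated termwise; the bound
makes it geometric with ratio `(2t)^2 < 1`. Finally `exp ≤ 2 cosh`. -/
theorem integrable_exp_mul_of_moment_bound {μ : Measure ℝ} (h : FiniteMoments μ)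
    (hb : ∀ n : ℕ, ∫ x, x ^ n ∂μ ≤ 2 ^ n * n.factorial) {t : ℝ} (ht : |t| < 1 / 2) :
    Integrable (fun x => Real.exp (t * x)) μ := by
  have hcosh : Integrable (fun x => Real.cosh (t * x)) μ := by
    refine ⟨by fun_prop, ?_⟩
    rw [hasFiniteIntegral_iff_ofReal (Filter.Eventually.of_forall fun x => (Real.cosh_pos _).le)]
    have hnn (x : ℝ) (n : ℕ) : 0 ≤ (t * x) ^ (2 * n) / ((2 * n).factorial : ℝ) := by
      rw [pow_mul]
      positivity
    have e1 (x : ℝ) : ENNReal.ofReal (Real.cosh (t * x)) =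
        ∑' n : ℕ, ENNReal.ofReal ((t * x) ^ (2 * n) / ((2 * n).factorial : ℝ)) := by
      rw [Real.cosh_eq_tsum, ENNReal.ofReal_tsum_of_nonneg (hnn x) (Real.hasSum_cosh _).summable]
    simp_rw [e1]
    rw [lintegral_tsum fun n => by fun_prop]
    have hr : (2 * t) ^ 2 < 1 := by
      rw [sq_lt_one_iff_abs_lt_one, abs_mul, abs_two]
      linarith
    have hle (n : ℕ) : ∫⁻ x, ENNReal.ofReal ((t * x) ^ (2 * n) / ((2 * n).factorial : ℝ)) ∂μ ≤
        ENNReal.ofReal (((2 * t) ^ 2) ^ n) := by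
      have hi : Integrable (fun x : ℝ => (t * x) ^ (2 * n) / ((2 * n).factorial : ℝ)) μ := by
        simp_rw [mul_pow]
        exact ((h _).const_mul _).div_const _
      rw [← ofReal_integral_eq_lintegral_ofReal hi (Filter.Eventually.of_forall fun x => hnn x n)]
      apply ENNReal.ofReal_le_ofReal
      simp_rw [mul_pow]
      rw [integral_div, integral_const_mul, div_le_iff₀ (by positivity)]
      calc t ^ (2 * n) * ∫ x, x ^ (2 * n) ∂μ
          ≤ t ^ (2 * n) * (2 ^ (2 * n) * (2 * n).factorial) :=
            mul_le_mul_of_nonneg_left (hb _) (by rw [pow_mul]; positivity)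
        _ = _ := by rw [pow_mul, pow_mul, ← mul_assoc, ← mul_pow]; ring
    refine (ENNReal.tsum_le_tsum hle).trans_lt ?_
    rw [← ENNReal.ofReal_tsum_of_nonneg (fun n => by positivity)
      (summable_geometric_of_lt_one (by positivity) hr)]
    exact ENNReal.ofReal_lt_top
  refine (hcosh.const_mul 2).mono' (by fun_prop) (Filter.Eventually.of_forall fun x => ?_)
  rw [Real.norm_of_nonneg (Real.exp_pos _).le, Real.cosh_eq]
  linarith [Real.exp_pos (-(t * x))]

open ProbabilityTheory in
/-- A measure whose moments satisfy `m_n ≤ 2 ^ n n!` is determined by its moments. -/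
theorem isMomentDeterminate_of_moment_bound {μ : Measure ℝ} [IsProbabilityMeasure μ]
    (h : FiniteMoments μ) (hb : ∀ n : ℕ, ∫ x, x ^ n ∂μ ≤ 2 ^ n * n.factorial) :
    IsMomentDeterminate μ := by
  intro ν _ hν heq
  have hsub {ρ : Measure ℝ} (h : FiniteMoments ρ)
      (hb : ∀ n : ℕ, ∫ x, x ^ n ∂ρ ≤ 2 ^ n * n.factorial) :
      Set.Ioo (-(1 / 2) : ℝ) (1 / 2) ⊆ interior (integrableExpSet id ρ) := by
    rw [isOpen_Ioo.subset_interior_iff]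
    exact fun t ht => integrable_exp_mul_of_moment_bound h hb (abs_lt.2 ht)
  have hμs := hsub h hb
  have hνs := hsub hν (by simpa only [heq] using hb)
  have h0 : (0 : ℝ) ∈ Set.Ioo (-(1 / 2) : ℝ) (1 / 2) := by norm_num
  -- Both generating functions are analytic at `0`, with Taylor coefficients given by the moments.
  have hmgf : mgf id ν =ᶠ[nhds 0] mgf id μ := by
    have h1 := hasFPowerSeriesAt_mgf (hνs h0)
    have h2 := hasFPowerSeriesAt_mgf (hμs h0)
    simp only [id, zero_mul, Real.exp_zero, mul_one, heq] at h1 h2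
    exact by
      filter_upwards [h1.eventually_hasSum, h2.eventually_hasSum] with x hx1 hx2
      simpa using hx1.unique hx2
  have hS : IsPreconnected {z : ℂ | z.re ∈ Set.Ioo (-(1 / 2) : ℝ) (1 / 2)} :=
    ((convex_Ioo _ _).linear_preimage Complex.reLm).isPreconnected
  have hEq : Set.EqOn (complexMGF id ν) (complexMGF id μ)
      {z : ℂ | z.re ∈ Set.Ioo (-(1 / 2) : ℝ) (1 / 2)} := by
    refine AnalyticOnNhd.eqOn_of_preconnected_of_frequently_eq
      (analyticOnNhd_complexMGF.mono fun z hz => hνs hz)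
      -- Identity theorem on the strip: agreement at real points accumulating at `0` suffices.
      (analyticOnNhd_complexMGF.mono fun z hz => hμs hz) hS (z₀ := 0) (by simp) ?_
    have hfr : ∃ᶠ x : ℝ in nhdsWithin 0 {0}ᶜ, complexMGF id ν x = complexMGF id μ x := by
      refine Filter.Eventually.frequently ?_
      filter_upwards [hmgf.filter_mono nhdsWithin_le_nhds] with x hx
      rw [complexMGF_ofReal, complexMGF_ofReal, hx]
    have ht : Filter.Tendsto (fun x : ℝ => (x : ℂ)) (nhdsWithin 0 {0}ᶜ) (nhdsWithin 0 {0}ᶜ) := by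
      refine tendsto_nhdsWithin_iff.2 ⟨?_, ?_⟩
      · exact (Complex.continuous_ofReal.tendsto' 0 0 rfl).mono_left nhdsWithin_le_nhds
      · filter_upwards [self_mem_nhdsWithin] with x hx
        simpa using hx
    exact ht.frequently hfr
  refine Measure.ext_of_charFun (funext fun t => ?_)
  rw [← complexMGF_id_mul_I, ← complexMGF_id_mul_I]
  exact hEq (by simp)

/-! ### The hyperbolic secant distribution -/

/-- The substitution `u = 1 / (1 + e^{-πx})` turns the integral into a Beta integral with parameters
`a` and `1 - a`, where `a = s/π + 1/2`; the reflection formula gives `B(a, 1 - a) = π / sin(πa) = π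
/ cos s`. -/
theorem lintegral_exp_mul_hyperbolicSecant {s : ℝ} (hs : |s| < Real.pi / 2) :
    ∫⁻ x, ENNReal.ofReal (Real.exp (s * x)) ∂hyperbolicSecant =
      ENNReal.ofReal (1 / Real.cos s) := by
  have hpi := Real.pi_pos
  obtain ⟨hs1, hs2⟩ := abs_lt.1 hs
  set a : ℝ := s / Real.pi + 1 / 2 with ha
  have hsa : s = Real.pi * (a - 1 / 2) := by rw [ha]; field_simp; ring
  have ha0 : 0 < a := by
    by_contra! h
    nlinarith
  have ha1 : 0 < 1 - a := by
    by_contra! h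
    nlinarith
  have hcos : 0 < Real.cos s := Real.cos_pos_of_mem_Ioo ⟨by linarith, hs2⟩
  have hbeta : ProbabilityTheory.beta a (1 - a) = Real.pi / Real.cos s := by
    rw [ProbabilityTheory.beta, Real.Gamma_mul_Gamma_one_sub, ← Real.sin_add_pi_div_two, hsa]
    simp only [add_sub_cancel, Real.Gamma_one, div_one]
    congr 2
    ring
  have key := ProbabilityTheory.lintegral_betaPDF_eq_one ha0 ha1
  rw [ProbabilityTheory.lintegral_betaPDF, hbeta] at key
  set f : ℝ → ℝ := fun x => (1 + Real.exp (-(Real.pi * x)))⁻¹ with hf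
  have hf' (x : ℝ) : HasDerivWithinAt f
      (Real.pi * Real.exp (-(Real.pi * x)) / (1 + Real.exp (-(Real.pi * x))) ^ 2) Set.univ x := by
    have h1 : HasDerivAt (fun x => 1 + Real.exp (-(Real.pi * x)))
        (Real.exp (-(Real.pi * x)) * (-(Real.pi * 1))) x :=
      (((hasDerivAt_id x).const_mul Real.pi).neg.exp).const_add 1
    have h2 := h1.inv (by positivity)
    convert! h2.hasDerivWithinAt using 1
    ring
  have hinj : Set.InjOn f Set.univ := by
    intro x _ y _ hxy
    simpa [hf, hpi.ne'] using hxy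
  have himg : f '' Set.univ = Set.Ioo 0 1 := by
    ext u
    simp only [Set.image_univ, Set.mem_range, Set.mem_Ioo, hf]
    constructor
    · rintro ⟨x, rfl⟩
      refine ⟨by positivity, inv_lt_one_of_one_lt₀ ?_⟩
      linarith [Real.exp_pos (-(Real.pi * x))]
    · rintro ⟨h0, h1⟩
      have h2 : 0 < u⁻¹ - 1 := sub_pos.2 ((one_lt_inv₀ h0).2 h1)
      refine ⟨-(Real.log (u⁻¹ - 1) / Real.pi), ?_⟩
      rw [mul_neg, neg_neg, mul_div_cancel₀ _ hpi.ne', Real.exp_log h2]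
      simp
  rw [← himg, lintegral_image_eq_lintegral_abs_deriv_mul MeasurableSet.univ
    (fun x _ => hf' x) hinj, Measure.restrict_univ] at key
  rw [hyperbolicSecant, lintegral_withDensity_eq_lintegral_mul _ (by fun_prop) (by fun_prop)]
  have hpt (x : ℝ) : ENNReal.ofReal |Real.pi * Real.exp (-(Real.pi * x)) /
        (1 + Real.exp (-(Real.pi * x))) ^ 2| * ENNReal.ofReal (1 / (Real.pi / Real.cos s) *
          f x ^ (a - 1) * (1 - f x) ^ (1 - a - 1)) =
      ENNReal.ofReal (Real.cos s) * (ENNReal.ofReal (1 / (Real.exp (Real.pi * x / 2) +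
        Real.exp (-(Real.pi * x / 2)))) * ENNReal.ofReal (Real.exp (s * x))) := by
    rw [abs_of_pos (by positivity), ← ENNReal.ofReal_mul (by positivity),
      ← ENNReal.ofReal_mul (by positivity), ← ENNReal.ofReal_mul hcos.le]
    congr 1
    set E := Real.exp (-(Real.pi * x / 2)) with hE
    have hE0 : 0 < E := Real.exp_pos _
    have hEE : Real.exp (-(Real.pi * x)) = E ^ 2 := by
      rw [hE, ← Real.exp_nat_mul]; congr 1; push_cast; ring
    have hEi : Real.exp (Real.pi * x / 2) = E⁻¹ := by
      rw [hE, Real.exp_neg, inv_inv]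
    have h1f : 1 - f x = E ^ 2 * (1 + E ^ 2)⁻¹ := by
      simp only [hf, hEE]
      field_simp
      ring
    have hfx : f x = (1 + E ^ 2)⁻¹ := by simp only [hf, hEE]
    have hsE : Real.exp (s * x) = (E ^ 2) ^ (1 - a - 1) * E := by
      rw [← hEE, ← Real.exp_mul, hE, ← Real.exp_add]
      congr 1
      rw [hsa]
      ring
    have hpos : 0 < (1 + E ^ 2)⁻¹ := by positivity
    rw [h1f, hfx, hEE, hEi, hsE, Real.mul_rpow (by positivity) hpos.le]
    have hcomb : ((1 + E ^ 2)⁻¹ : ℝ) ^ (a - 1) * ((1 + E ^ 2)⁻¹) ^ (1 - a - 1) = 1 + E ^ 2 := by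
      rw [← Real.rpow_add hpos, show a - 1 + (1 - a - 1) = -1 by ring, Real.rpow_neg_one, inv_inv]
    calc _ = Real.pi * E ^ 2 / (1 + E ^ 2) ^ 2 * (1 / (Real.pi / Real.cos s)) *
          (((1 + E ^ 2)⁻¹ : ℝ) ^ (a - 1) * ((1 + E ^ 2)⁻¹) ^ (1 - a - 1)) *
            (E ^ 2) ^ (1 - a - 1) := by ring
      _ = _ := by
        rw [hcomb]
        field_simp
  simp_rw [hpt] at key
  rw [lintegral_const_mul _ (by fun_prop)] at key
  simp only [Pi.mul_apply]
  rw [one_div (Real.cos s), ENNReal.ofReal_inv_of_pos hcos]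
  exact ENNReal.eq_inv_of_mul_eq_one_left (by rwa [mul_comm])

theorem isProbabilityMeasure_hyperbolicSecant : IsProbabilityMeasure hyperbolicSecant := by
  refine ⟨?_⟩
  simpa using lintegral_exp_mul_hyperbolicSecant (s := 0) (by simpa using Real.pi_pos)

theorem isNegInvariant_hyperbolicSecant : hyperbolicSecant.IsNegInvariant := by
  refine ⟨?_⟩
  ext t ht
  rw [Measure.neg, Measure.map_apply measurable_neg ht, hyperbolicSecant,
    withDensity_apply _ ht, withDensity_apply _ (measurable_neg ht),
    ← (Measure.measurePreserving_neg volume).setLIntegral_comp_preimage_emb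
      (MeasurableEquiv.neg ℝ).measurableEmbedding]
  simp only [Set.neg_preimage, neg_neg, mul_neg, neg_div, add_comm]

open ProbabilityTheory in
theorem Ioo_subset_interior_integrableExpSet_hyperbolicSecant :
    Set.Ioo (-(Real.pi / 2)) (Real.pi / 2) ⊆
      interior (integrableExpSet id hyperbolicSecant) := by
  rw [isOpen_Ioo.subset_interior_iff]
  intro s hs
  refine ⟨by fun_prop, ?_⟩
  rw [hasFiniteIntegral_iff_ofReal (.of_forall fun x => (Real.exp_pos _).le)]
  simp only [id]
  rw [lintegral_exp_mul_hyperbolicSecant (abs_lt.2 hs)]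
  exact ENNReal.ofReal_lt_top

theorem integral_exp_mul_hyperbolicSecant {s : ℝ} (hs : |s| < Real.pi / 2) :
    ∫ x, Real.exp (s * x) ∂hyperbolicSecant = 1 / Real.cos s := by
  have hcos : 0 < Real.cos s := Real.cos_pos_of_mem_Ioo (abs_lt.1 hs)
  rw [integral_eq_lintegral_of_nonneg_ae (.of_forall fun x => (Real.exp_pos _).le) (by fun_prop),
    lintegral_exp_mul_hyperbolicSecant hs, ENNReal.toReal_ofReal (by positivity)]

open ProbabilityTheory in
theorem integrable_eval_mul_exp {μ : Measure ℝ} {s : ℝ}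
    (hs : s ∈ interior (integrableExpSet id μ)) (q : ℝ[X]) :
    Integrable (fun x => q.eval x * Real.exp (s * x)) μ := by
  simp_rw [eval_eq_sum_range, Finset.sum_mul, mul_assoc]
  exact integrable_finsetSum _ fun i _ =>
    (integrable_pow_mul_exp_of_mem_interior_integrableExpSet hs i).const_mul _

open ProbabilityTheory in
theorem hasDerivAt_integral_eval_mul_exp {μ : Measure ℝ} {s : ℝ}
    (hs : s ∈ interior (integrableExpSet id μ)) (q : ℝ[X]) :
    HasDerivAt (fun s => ∫ x, q.eval x * Real.exp (s * x) ∂μ)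
      (∫ x, (X * q).eval x * Real.exp (s * x) ∂μ) s := by
  have hi (n : ℕ) {s : ℝ} (hs : s ∈ interior (integrableExpSet id μ)) :
      Integrable (fun x => x ^ n * Real.exp (s * x)) μ :=
    integrable_pow_mul_exp_of_mem_interior_integrableExpSet hs n
  have h1 : HasDerivAt (fun s => ∑ i ∈ Finset.range (q.natDegree + 1),
        q.coeff i * ∫ x, x ^ i * Real.exp (s * x) ∂μ)
      (∑ i ∈ Finset.range (q.natDegree + 1),
        q.coeff i * ∫ x, x ^ (i + 1) * Real.exp (s * x) ∂μ) s :=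
    HasDerivAt.fun_sum fun i _ => (hasDerivAt_integral_pow_mul_exp_real hs i).const_mul _
  have h2 : ∫ x, (X * q).eval x * Real.exp (s * x) ∂μ = ∑ i ∈ Finset.range (q.natDegree + 1),
      q.coeff i * ∫ x, x ^ (i + 1) * Real.exp (s * x) ∂μ := by
    simp_rw [← integral_const_mul]
    rw [← integral_finsetSum _ fun i _ => (hi _ hs).const_mul _]
    congr 1 with x
    rw [eval_mul, eval_X, eval_eq_sum_range, Finset.mul_sum, Finset.sum_mul]
    exact Finset.sum_congr rfl fun i _ => by ring
  rw [h2]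
  refine h1.congr_of_eventuallyEq ?_
  filter_upwards [isOpen_interior.mem_nhds hs] with t ht
  simp_rw [← integral_const_mul]
  rw [← integral_finsetSum _ fun i _ => (hi _ ht).const_mul _]
  congr 1 with x
  rw [eval_eq_sum_range, Finset.sum_mul]
  exact Finset.sum_congr rfl fun i _ => by ring

/-- This is the recurrence `x P_{n+1} = P_{n+2} + (n+1)^2 P_n` with `d/ds` in place of
multiplication by `x`. -/
theorem hasDerivAt_sin_pow_div_cos_pow {s : ℝ} (hs : Real.cos s ≠ 0) (n : ℕ) :
    HasDerivAt (fun s => (n + 1).factorial * Real.sin s ^ (n + 1) / Real.cos s ^ (n + 2))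
      ((n + 2).factorial * Real.sin s ^ (n + 2) / Real.cos s ^ (n + 3) +
        (n + 1 : ℝ) ^ 2 * (n.factorial * Real.sin s ^ n / Real.cos s ^ (n + 1))) s := by
  have h := ((((Real.hasDerivAt_sin s).pow (n + 1)).const_mul ((n + 1).factorial : ℝ)).div
    ((Real.hasDerivAt_cos s).pow (n + 2)) (pow_ne_zero _ hs))
  convert! h using 1
  simp only [Nat.factorial_succ, Nat.add_sub_cancel, show n + 2 - 1 = n + 1 from rfl, Pi.pow_apply]
  push_cast
  field_simp
  ring

-- Differentiating in `s` multiplies the integrand by `x`, so both sides obey the same recurrence.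
open ProbabilityTheory in
theorem integral_jacobiPoly_mul_exp_hyperbolicSecant {ω : ℕ → ℝ} (hω : ∀ n, ω n = (n : ℝ) ^ 2)
    (n : ℕ) : ∀ s : ℝ, |s| < Real.pi / 2 →
      ∫ x, (jacobiPoly ω n).eval x * Real.exp (s * x) ∂hyperbolicSecant =
        n.factorial * Real.sin s ^ n / Real.cos s ^ (n + 1) := by
  have hI {s : ℝ} (hs : |s| < Real.pi / 2) : s ∈ interior (integrableExpSet id hyperbolicSecant) :=
    Ioo_subset_interior_integrableExpSet_hyperbolicSecant (abs_lt.1 hs)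
  have hev {s : ℝ} (hs : |s| < Real.pi / 2) : ∀ᶠ t in nhds s, |t| < Real.pi / 2 :=
    (continuous_abs.tendsto s).eventually (gt_mem_nhds hs)
  have hcos {s : ℝ} (hs : |s| < Real.pi / 2) : Real.cos s ≠ 0 :=
    (Real.cos_pos_of_mem_Ioo (abs_lt.1 hs)).ne'
  induction n using Nat.strong_induction_on with
  | _ n ih =>
    intro s hs
    match n with
    | 0 => simpa [jacobiPoly] using integral_exp_mul_hyperbolicSecant hs
    | 1 =>
      have h1 := hasDerivAt_integral_eval_mul_exp (hI hs) 1
      have h2 : HasDerivAt (fun s => 1 / Real.cos s) (Real.sin s / Real.cos s ^ 2) s := by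
        convert! (Real.hasDerivAt_cos s).inv (hcos hs) using 1
        · ext; simp
        · ring
      have h3 := h2.congr_of_eventuallyEq (f₁ := fun s =>
          ∫ x, (1 : ℝ[X]).eval x * Real.exp (s * x) ∂hyperbolicSecant) (by
        filter_upwards [hev hs] with t ht
        simpa using integral_exp_mul_hyperbolicSecant ht)
      simpa [jacobiPoly] using h1.unique h3
    | n + 2 =>
      have h1 := hasDerivAt_integral_eval_mul_exp (hI hs) (jacobiPoly ω (n + 1))
      have h2 := (hasDerivAt_sin_pow_div_cos_pow (hcos hs) n).congr_of_eventuallyEq (f₁ := fun s =>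
          ∫ x, (jacobiPoly ω (n + 1)).eval x * Real.exp (s * x) ∂hyperbolicSecant) (by
        filter_upwards [hev hs] with t ht using ih (n + 1) (by omega) t ht)
      have h3 := h1.unique h2
      have h4 : ∫ x, (X * jacobiPoly ω (n + 1)).eval x * Real.exp (s * x) ∂hyperbolicSecant =
          ∫ x, (jacobiPoly ω (n + 2)).eval x * Real.exp (s * x) ∂hyperbolicSecant +
          (n + 1 : ℝ) ^ 2 *
            ∫ x, (jacobiPoly ω n).eval x * Real.exp (s * x) ∂hyperbolicSecant := by
        rw [← integral_const_mul, ← integral_add (integrable_eval_mul_exp (hI hs) _)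
          ((integrable_eval_mul_exp (hI hs) _).const_mul _)]
        congr 1 with x
        rw [X_mul_jacobiPoly, hω]
        simp only [eval_mul, eval_add, eval_C]
        push_cast
        ring
      rw [h4, ih n (by omega) s hs] at h3
      exact add_right_cancel h3

open ProbabilityTheory in
theorem isSymmetricWithJacobi_hyperbolicSecant {ω : ℕ → ℝ} (hω : ∀ n, ω n = (n : ℝ) ^ 2) :
    IsSymmetricWithJacobi hyperbolicSecant ω := by
  have h0 : |(0 : ℝ)| < Real.pi / 2 := by simpa using Real.pi_pos
  refine isSymmetricWithJacobi_iff.2 ⟨isProbabilityMeasure_hyperbolicSecant,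
    isNegInvariant_hyperbolicSecant, fun n => ?_, fun n => ?_⟩
  · simpa using integrable_pow_mul_exp_of_mem_interior_integrableExpSet
      (Ioo_subset_interior_integrableExpSet_hyperbolicSecant (abs_lt.1 h0)) n
  · simpa using integral_jacobiPoly_mul_exp_hyperbolicSecant hω (n + 1) 0 h0

/-! ### Weak limits and convergence of moments -/

open Filter Topology

theorem isTightMeasureSet_of_second_moment {μ : ℕ → ProbabilityMeasure ℝ} {C : ℝ}
    (hfin : ∀ N, FiniteMoments (μ N)) (hC : ∀ᶠ N in atTop, ∫ x, x ^ 2 ∂(μ N : Measure ℝ) ≤ C) :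
    IsTightMeasureSet (Set.range fun N => (μ N : Measure ℝ)) := by
  apply isTightMeasureSet_range_of_tendsto_limsup_measure_norm_gt
  have hlim : Tendsto (fun r : ℝ => ENNReal.ofReal (C / r ^ 2)) atTop (𝓝 0) := by
    rw [← ENNReal.ofReal_zero]
    exact (ENNReal.continuous_ofReal.tendsto 0).comp
      (tendsto_const_nhds.div_atTop (tendsto_pow_atTop two_ne_zero))
  refine tendsto_of_tendsto_of_tendsto_of_le_of_le' tendsto_const_nhds hlim
    (.of_forall fun _ => zero_le) ?_
  filter_upwards [eventually_gt_atTop 0] with r hr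
  refine limsup_le_of_le (by isBoundedDefault) ?_
  filter_upwards [hC] with N hN
  have h1 := mul_meas_ge_le_integral_of_nonneg (μ := (μ N : Measure ℝ)) (f := fun x : ℝ => x ^ 2)
    (.of_forall fun x => sq_nonneg x) (hfin N 2) (r ^ 2)
  have hr2 : 0 < r ^ 2 := by positivity
  calc (μ N : Measure ℝ) {x | r < ‖x‖} ≤ (μ N : Measure ℝ) {x | r ^ 2 ≤ x ^ 2} := by
        refine measure_mono fun x hx => ?_
        simp only [Set.mem_ofPred_eq, Real.norm_eq_abs] at hx ⊢
        rw [← sq_abs x]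
        gcongr
    _ = ENNReal.ofReal ((μ N : Measure ℝ).real {x | r ^ 2 ≤ x ^ 2}) := by simp
    _ ≤ ENNReal.ofReal (C / r ^ 2) := by
        apply ENNReal.ofReal_le_ofReal
        rw [le_div_iff₀ hr2, mul_comm]
        exact h1.trans hN

theorem finiteMoments_of_tendsto {μ : ℕ → ProbabilityMeasure ℝ} {ν : ProbabilityMeasure ℝ}
    {C : ℕ → ℝ} (hfin : ∀ N, FiniteMoments (μ N))
    (hC : ∀ k, ∀ᶠ N in atTop, ∫ x, x ^ (2 * k) ∂(μ N : Measure ℝ) ≤ C k)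
    (hν : Tendsto μ atTop (𝓝 ν)) :
    FiniteMoments ν ∧ ∀ k, ∫ x, x ^ (2 * k) ∂(ν : Measure ℝ) ≤ C k := by
  have hnn (k : ℕ) (x : ℝ) : 0 ≤ x ^ (2 * k) := by rw [pow_mul]; positivity
  have hC0 (k : ℕ) : 0 ≤ C k := by
    obtain ⟨N, hN⟩ := (hC k).exists
    exact (integral_nonneg (hnn k)).trans hN
  have hle (k : ℕ) : ∫⁻ x, ENNReal.ofReal (x ^ (2 * k)) ∂(ν : Measure ℝ) ≤
      ENNReal.ofReal (C k) := by
    -- Fatou's lemma for weak convergence: no boundedness of `x ^ (2 * k)` is needed for an upper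
    -- bound on the limit.
    refine (lintegral_le_liminf_lintegral_of_forall_isOpen_measure_le_liminf_measure
      (f := fun x : ℝ => x ^ (2 * k)) (by fun_prop) (hnn k) fun G hG =>
        ProbabilityMeasure.le_liminf_measure_open_of_tendsto hν hG).trans ?_
    refine liminf_le_of_frequently_le' (Eventually.frequently ?_)
    filter_upwards [hC k] with N hN
    rw [← ofReal_integral_eq_lintegral_ofReal (hfin N _) (.of_forall (hnn k))]
    exact ENNReal.ofReal_le_ofReal hN
  have heven (k : ℕ) : Integrable (fun x : ℝ => x ^ (2 * k)) (ν : Measure ℝ) := by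
    refine ⟨by fun_prop, ?_⟩
    rw [hasFiniteIntegral_iff_ofReal (.of_forall (hnn k))]
    exact (hle k).trans_lt ENNReal.ofReal_lt_top
  refine ⟨fun n => ?_, fun k => ?_⟩
  -- Odd powers are covered by `|x| ^ n ≤ 1 + x ^ (2 * n)`.
  · refine ((integrable_const (1 : ℝ)).add (heven n)).mono' (by fun_prop) (.of_forall fun x => ?_)
    simp only [Pi.add_apply, norm_pow, Real.norm_eq_abs]
    rw [mul_comm, pow_mul, ← sq_abs, abs_pow]
    nlinarith [sq_nonneg (|x| ^ n - 1), sq_nonneg (|x| ^ n)]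
  · rw [integral_eq_lintegral_of_nonneg_ae (.of_forall (hnn k)) (by fun_prop)]
    exact ENNReal.toReal_le_of_le_ofReal (hC0 k) (hle k)

theorem abs_sub_truncation_le {M : ℝ} (hM : 0 < M) (y : ℝ) :
    |y - max (-M) (min M y)| ≤ y ^ 2 / M := by
  rw [le_div_iff₀ hM]
  rcases le_total M y with h | h
  · rw [min_eq_left h, max_eq_right (by linarith), abs_of_nonneg (by linarith)]
    nlinarith
  · rw [min_eq_right h]
    rcases le_total (-M) y with h' | h'
    · rw [max_eq_right h', sub_self, abs_zero, zero_mul]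
      positivity
    · rw [max_eq_left h', abs_of_nonpos (by linarith)]
      nlinarith

/-- The bound on the moment of order `2k` gives uniform integrability of `x ^ k`: truncating at
height `M` costs at most `C / M`, uniformly in the measure. -/
theorem tendsto_moment {μ : ℕ → ProbabilityMeasure ℝ} {ν : ProbabilityMeasure ℝ}
    {C : ℝ} {k : ℕ} (hfin : ∀ N, FiniteMoments (μ N)) (hfinν : FiniteMoments ν)
    (hC : ∀ᶠ N in atTop, ∫ x, x ^ (2 * k) ∂(μ N : Measure ℝ) ≤ C)
    (hCν : ∫ x, x ^ (2 * k) ∂(ν : Measure ℝ) ≤ C) (hν : Tendsto μ atTop (𝓝 ν)) :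
    Tendsto (fun N => ∫ x, x ^ k ∂(μ N : Measure ℝ)) atTop (𝓝 (∫ x, x ^ k ∂(ν : Measure ℝ))) := by
  have hC0 : 0 ≤ C := (integral_nonneg fun x => by rw [pow_mul]; positivity).trans hCν
  rw [Metric.tendsto_nhds]
  intro ε hε
  -- Chosen so that `C / M < ε / 3`; the `+ 1` keeps `M` positive when `C = 0`.
  set M : ℝ := (3 * C + 1) / ε with hM
  have hM0 : 0 < M := by positivity
  have hφb (x : ℝ) : ‖max (-M) (min M (x ^ k))‖ ≤ M := by
    rw [Real.norm_eq_abs, abs_le]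
    exact ⟨le_max_left _ _, max_le (by linarith) (min_le_left _ _)⟩
  let φ : BoundedContinuousFunction ℝ ℝ :=
    BoundedContinuousFunction.ofNormedAddCommGroup (fun x : ℝ => max (-M) (min M (x ^ k)))
      (by fun_prop) M hφb
  have hclose (ρ : ProbabilityMeasure ℝ) (h : FiniteMoments ρ)
      (hρ : ∫ x, x ^ (2 * k) ∂(ρ : Measure ℝ) ≤ C) :
      |∫ x, x ^ k ∂(ρ : Measure ℝ) - ∫ x, φ x ∂(ρ : Measure ℝ)| ≤ C / M := by
    rw [← integral_sub (h k) (φ.integrable _)]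
    refine (abs_integral_le_integral_abs).trans ?_
    calc ∫ x, |x ^ k - φ x| ∂(ρ : Measure ℝ) ≤ ∫ x, x ^ (2 * k) / M ∂(ρ : Measure ℝ) := by
          refine integral_mono ((h k).sub (φ.integrable _)).abs ((h _).div_const _) fun x => ?_
          have := abs_sub_truncation_le hM0 (x ^ k)
          rwa [← pow_mul, mul_comm k] at this
      _ ≤ C / M := by
          rw [integral_div]
          gcongr
  have hCM : C / M < ε / 3 := by
    rw [hM, div_div_eq_mul_div, div_lt_div_iff₀ (by positivity) (by norm_num)]
    nlinarith
  have hφ := (ProbabilityMeasure.tendsto_iff_forall_integral_tendsto.1 hν) φ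
  filter_upwards [hC, (Metric.tendsto_nhds.1 hφ) (ε / 3) (by positivity)] with N h1 h2
  have h3 := hclose (μ N) (hfin N) h1
  have h4 := hclose ν hfinν hCν
  rw [Real.dist_eq, abs_lt] at h2 ⊢
  rw [abs_le] at h3 h4
  constructor <;> linarith

/-- Helly's selection theorem for moment sequences. -/
theorem exists_tendsto_subseq_of_moments {μ : ℕ → ProbabilityMeasure ℝ} {m : ℕ → ℝ}
    (hfin : ∀ N, FiniteMoments (μ N))
    (hm : ∀ k, ∀ᶠ N in atTop, ∫ x, x ^ k ∂(μ N : Measure ℝ) = m k) :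
    ∃ (ν : ProbabilityMeasure ℝ) (φ : ℕ → ℕ), StrictMono φ ∧ Tendsto (μ ∘ φ) atTop (𝓝 ν) ∧
      FiniteMoments ν ∧ ∀ k, ∫ x, x ^ k ∂(ν : Measure ℝ) = m k := by
  have htight := isTightMeasureSet_of_second_moment hfin ((hm 2).mono fun N h => h.le)
  have hcomp : IsCompact (closure (Set.range μ)) := by
    apply isCompact_closure_of_isTightMeasureSet
    convert! htight using 1
    ext
    simp
  obtain ⟨ν, -, φ, hφ, hν⟩ := hcomp.tendsto_subseq fun N => subset_closure (Set.mem_range_self N)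
  have hmφ (k : ℕ) : ∀ᶠ N in atTop, ∫ x, x ^ k ∂((μ ∘ φ) N : Measure ℝ) = m k :=
    hφ.tendsto_atTop.eventually (hm k)
  have hle (k : ℕ) := (hmφ (2 * k)).mono fun N h => h.le
  obtain ⟨h1, h2⟩ := finiteMoments_of_tendsto (fun N => hfin (φ N)) hle hν
  refine ⟨ν, φ, hφ, hν, h1, fun k => ?_⟩
  exact tendsto_nhds_unique (tendsto_moment (fun N => hfin (φ N)) h1 (hle k) (h2 k) hν)
    (tendsto_const_nhds.congr' ((hmφ k).mono fun N h => h.symm))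

/-! ### Spectral measures of symmetric operators in finite dimension -/

section SpectralMeasure

variable {V : Type*} [NormedAddCommGroup V] [InnerProductSpace ℝ V] [FiniteDimensional ℝ V]
  {T : V →ₗ[ℝ] V}

/-- The spectral measure of the symmetric operator `T` at the vector `e`. -/
noncomputable def spectralMeasure (hT : T.IsSymmetric) (e : V) : Measure ℝ :=
  ∑ i, ENNReal.ofReal (inner ℝ (hT.eigenvectorBasis rfl i) e ^ 2) •
    Measure.dirac (hT.eigenvalues rfl i)

variable (hT : T.IsSymmetric) (e : V)

theorem spectralMeasure_apply {s : Set ℝ} [DecidablePred (· ∈ s)] (hs : MeasurableSet s) :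
    spectralMeasure hT e s = ENNReal.ofReal (∑ i,
      if hT.eigenvalues rfl i ∈ s then inner ℝ (hT.eigenvectorBasis rfl i) e ^ 2 else 0) := by
  rw [ENNReal.ofReal_sum_of_nonneg fun i _ => by split_ifs <;> positivity]
  simp only [spectralMeasure, Measure.coe_finsetSum, Finset.sum_apply, Measure.smul_apply,
    Measure.dirac_apply' _ hs, smul_eq_mul]
  refine Finset.sum_congr rfl fun i _ => ?_
  split_ifs with h <;> simp [h]

theorem isProbabilityMeasure_spectralMeasure (he : ‖e‖ = 1) :
    IsProbabilityMeasure (spectralMeasure hT e) := by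
  classical
  refine ⟨?_⟩
  rw [spectralMeasure_apply hT e MeasurableSet.univ]
  simp only [Set.mem_univ, if_true]
  rw [OrthonormalBasis.sum_sq_inner_right, he]
  simp

theorem finiteMoments_spectralMeasure : FiniteMoments (spectralMeasure hT e) := fun n => by
  refine integrable_finsetSum_measure.2 fun i _ => ?_
  exact (integrable_dirac (by simp)).smul_measure ENNReal.ofReal_ne_top

theorem integral_eval_spectralMeasure (q : ℝ[X]) :
    ∫ x, q.eval x ∂(spectralMeasure hT e) = inner ℝ e (aeval T q e) := by
  have h1 : ∫ x, q.eval x ∂(spectralMeasure hT e) =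
      ∑ i, inner ℝ (hT.eigenvectorBasis rfl i) e ^ 2 * q.eval (hT.eigenvalues rfl i) := by
    rw [spectralMeasure, integral_finsetSum_measure fun i _ =>
      (integrable_dirac (by simp)).smul_measure ENNReal.ofReal_ne_top]
    refine Finset.sum_congr rfl fun i _ => ?_
    rw [integral_smul_measure, integral_dirac, ENNReal.toReal_ofReal (sq_nonneg _), smul_eq_mul]
  have h2 (i) : aeval T q (hT.eigenvectorBasis rfl i) =
      q.eval (hT.eigenvalues rfl i) • hT.eigenvectorBasis rfl i :=
    Module.End.aeval_apply_of_hasEigenvector (hT.hasEigenvector_eigenvectorBasis rfl i)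
  rw [h1]
  conv_rhs => rw [← (hT.eigenvectorBasis rfl).sum_repr' e, map_sum]
  rw [(hT.eigenvectorBasis rfl).sum_repr' e, inner_sum]
  refine Finset.sum_congr rfl fun i _ => ?_
  rw [map_smul, h2, inner_smul_right, inner_smul_right, real_inner_comm]
  ring

theorem inner_eigenvectorBasis_apply (u : V) (i) :
    inner ℝ (hT.eigenvectorBasis rfl i) (T u) =
      hT.eigenvalues rfl i * inner ℝ (hT.eigenvectorBasis rfl i) u := by
  rw [← hT, hT.apply_eigenvectorBasis, inner_smul_left]
  simp

/-- In the eigenbasis, each coordinate of `e = T u` is the eigenvalue times that of `u`, and only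
eigenvalues below `ε` in absolute value count. -/
theorem spectralMeasure_ball_le {u : V} (hu : T u = e) (ε : ℝ) :
    spectralMeasure hT e (Metric.ball 0 ε) ≤ ENNReal.ofReal (ε ^ 2 * ‖u‖ ^ 2) := by
  classical
  rw [spectralMeasure_apply hT e Metric.isOpen_ball.measurableSet]
  apply ENNReal.ofReal_le_ofReal
  rw [← (hT.eigenvectorBasis rfl).sum_sq_inner_right u, Finset.mul_sum]
  refine Finset.sum_le_sum fun i _ => ?_
  split_ifs with h
  · rw [← hu, inner_eigenvectorBasis_apply, mul_pow]
    rw [mem_ball_zero_iff, Real.norm_eq_abs] at h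
    have : hT.eigenvalues rfl i ^ 2 ≤ ε ^ 2 := sq_le_sq' (neg_le_of_abs_le h.le) (le_of_abs_le h.le)
    gcongr
  · positivity

/-- A kernel vector `u` has coordinates only at the eigenvalue `0`; Cauchy–Schwarz then compares
`⟨u, e⟩` with the part of `e` lying there. -/
theorem le_spectralMeasure_singleton_zero {u : V} (hu : T u = 0) :
    ENNReal.ofReal (inner ℝ u e ^ 2) ≤
      ENNReal.ofReal (‖u‖ ^ 2) * spectralMeasure hT e {0} := by
  classical
  rw [spectralMeasure_apply hT e (measurableSet_singleton 0),
    ← ENNReal.ofReal_mul (by positivity)]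
  apply ENNReal.ofReal_le_ofReal
  have h1 : inner ℝ u e = ∑ i, inner ℝ (hT.eigenvectorBasis rfl i) u *
      (if hT.eigenvalues rfl i ∈ ({0} : Set ℝ) then
        inner ℝ (hT.eigenvectorBasis rfl i) e else 0) := by
    rw [← (hT.eigenvectorBasis rfl).sum_inner_mul_inner u e]
    refine Finset.sum_congr rfl fun i _ => ?_
    have := inner_eigenvectorBasis_apply hT u i
    rw [hu, inner_zero_right, eq_comm, mul_eq_zero] at this
    rw [real_inner_comm]
    split_ifs with h
    · rfl
    · rw [this.resolve_left h, zero_mul, zero_mul]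
  rw [h1, ← (hT.eigenvectorBasis rfl).sum_sq_inner_right u]
  refine (Finset.sum_mul_sq_le_sq_mul_sq _ _ _).trans_eq ?_
  congr 1
  refine Finset.sum_congr rfl fun i _ => ?_
  split_ifs <;> simp

end SpectralMeasure

/-! ### Truncated Jacobi matrices and their quadrature measures -/

/-- The `N × N` truncation of the Jacobi matrix with zero diagonal and off-diagonal entries
`b 1, b 2, …`. -/
def jacobiMatrix (b : ℕ → ℝ) (N : ℕ) : Matrix (Fin N) (Fin N) ℝ :=
  fun i j => (if (j : ℕ) = i + 1 then b j else 0) + (if (i : ℕ) = j + 1 then b i else 0)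

theorem isSymmetric_jacobiMatrix (b : ℕ → ℝ) (N : ℕ) :
    (Matrix.toEuclideanLin (jacobiMatrix b N)).IsSymmetric := by
  rw [Matrix.isSymmetric_toEuclideanLin_iff]
  ext i j
  simp [jacobiMatrix, add_comm]

/-- The vector of the first `N` entries of a sequence. -/
def truncate (N : ℕ) (x : ℕ → ℝ) : EuclideanSpace ℝ (Fin N) :=
  WithLp.toLp 2 fun i => x i

/-- With `x N = 0` the last row does not feel the cutoff, and `b 0 = 0` removes the spurious term at
`i = 0`, where `i - 1` is `0`. -/
theorem jacobiMatrix_apply_truncate {b : ℕ → ℝ} (hb : b 0 = 0) {N : ℕ} {x : ℕ → ℝ} (hx : x N = 0) :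
    Matrix.toEuclideanLin (jacobiMatrix b N) (truncate N x) =
      truncate N fun i => b (i + 1) * x (i + 1) + b i * x (i - 1) := by
  ext ⟨i, hi⟩
  simp only [truncate, Matrix.toLpLin_toLp, Matrix.mulVec, dotProduct, jacobiMatrix,
    Matrix.toLin'_apply]
  rw [Fin.sum_univ_eq_sum_range (fun j => ((if j = i + 1 then b j else 0) +
    (if i = j + 1 then b i else 0)) * x j) N]
  simp only [add_mul, Finset.sum_add_distrib, ite_mul, zero_mul, Finset.sum_ite_eq',
    Finset.mem_range]
  congr 1
  · split_ifs with h
    · rfl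
    · rw [show i + 1 = N by omega, hx, mul_zero]
  · cases i with
    | zero => simp [hb]
    | succ i => simp [Finset.sum_ite_eq, show i < N by omega]

theorem jacobiMatrix_apply_single {b : ℕ → ℝ} (hb : b 0 = 0) {N n : ℕ} (hn : n + 1 < N) :
    Matrix.toEuclideanLin (jacobiMatrix b N) (truncate N (Pi.single (n + 1) 1)) =
      b (n + 2) • truncate N (Pi.single (n + 2) 1) + b (n + 1) • truncate N (Pi.single n 1) := by
  rw [jacobiMatrix_apply_truncate hb (Pi.single_eq_of_ne hn.ne' _)]
  ext ⟨i, hi⟩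
  simp only [truncate, PiLp.add_apply, PiLp.smul_apply, smul_eq_mul, Pi.single_apply]
  rcases i with _ | i
  · by_cases h : n = 0
    · simp [h, hb]
    · simp [h, Ne.symm h, hb]
  · grind

theorem jacobiMatrix_apply_single_zero {b : ℕ → ℝ} (hb : b 0 = 0) {N : ℕ} (hN : 0 < N) :
    Matrix.toEuclideanLin (jacobiMatrix b N) (truncate N (Pi.single 0 1)) =
      b 1 • truncate N (Pi.single 1 1) := by
  rw [jacobiMatrix_apply_truncate hb (Pi.single_eq_of_ne hN.ne' _)]
  ext ⟨i, hi⟩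
  simp only [truncate, PiLp.smul_apply, smul_eq_mul, Pi.single_apply]
  rcases i with _ | i
  · simp [hb]
  · grind

/-- Thus `P_n(T)` carries the first basis vector to a multiple of the `n`-th one, which for `n ≥ 1`
is orthogonal to it; this is why the quadrature measure integrates `P_n` to `0`. -/
theorem aeval_jacobiPoly_jacobiMatrix {b : ℕ → ℝ} (hb : b 0 = 0) {ω : ℕ → ℝ}
    (hω : ∀ n, ω n = b n ^ 2) {N : ℕ} (n : ℕ) (hn : n < N) :
    aeval (Matrix.toEuclideanLin (jacobiMatrix b N)) (jacobiPoly ω n)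
        (truncate N (Pi.single 0 1)) =
      (∏ i ∈ Finset.range n, b (i + 1)) • truncate N (Pi.single n 1) := by
  induction n using Nat.strong_induction_on with
  | _ n ih =>
    match n with
    | 0 => simp [jacobiPoly]
    | 1 => simp [jacobiPoly, jacobiMatrix_apply_single_zero hb (Nat.zero_lt_of_lt hn)]
    | n + 2 =>
      have h1 := ih (n + 1) (by omega) (by omega)
      have h2 := ih n (by omega) (by omega)
      rw [jacobiPoly, map_sub, map_mul, map_mul, aeval_X, aeval_C, LinearMap.sub_apply,
        Module.End.mul_apply, Module.End.mul_apply, h1, h2, map_smul,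
        jacobiMatrix_apply_single hb (by omega), Module.algebraMap_end_apply, hω,
        Finset.prod_range_succ _ (n + 1), Finset.prod_range_succ _ n]
      module

theorem norm_truncate_sq (N : ℕ) (x : ℕ → ℝ) :
    ‖truncate N x‖ ^ 2 = ∑ i ∈ Finset.range N, x i ^ 2 := by
  rw [EuclideanSpace.real_norm_sq_eq, ← Fin.sum_univ_eq_sum_range (fun i => x i ^ 2)]
  rfl

theorem inner_truncate (N : ℕ) (x y : ℕ → ℝ) :
    inner ℝ (truncate N x) (truncate N y) = ∑ i ∈ Finset.range N, x i * y i := by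
  rw [← Fin.sum_univ_eq_sum_range (fun i => x i * y i)]
  simp [truncate, PiLp.inner_apply, mul_comm]

theorem norm_truncate_single_zero (N : ℕ) : ‖truncate (N + 1) (Pi.single 0 1)‖ = 1 := by
  rw [← sq_eq_sq₀ (norm_nonneg _) zero_le_one, norm_truncate_sq]
  simp [Pi.single_apply]

/-- The quadrature measure given by the `(N + 1) × (N + 1)` truncated Jacobi matrix. -/
noncomputable def quadrature (b : ℕ → ℝ) (N : ℕ) : ProbabilityMeasure ℝ :=
  ⟨spectralMeasure (isSymmetric_jacobiMatrix b (N + 1)) (truncate (N + 1) (Pi.single 0 1)),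
    isProbabilityMeasure_spectralMeasure _ _ (norm_truncate_single_zero N)⟩

theorem finiteMoments_quadrature (b : ℕ → ℝ) (N : ℕ) : FiniteMoments (quadrature b N) :=
  finiteMoments_spectralMeasure _ _

theorem integral_jacobiPoly_quadrature {b : ℕ → ℝ} (hb : b 0 = 0) {ω : ℕ → ℝ}
    (hω : ∀ n, ω n = b n ^ 2) {N n : ℕ} (hn : n < N) :
    ∫ x, (jacobiPoly ω (n + 1)).eval x ∂(quadrature b N : Measure ℝ) = 0 := by
  refine (integral_eval_spectralMeasure _ _ _).trans ?_
  rw [aeval_jacobiPoly_jacobiMatrix hb hω (n + 1) (by omega), inner_smul_right, inner_truncate]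
  simp [Pi.single_apply]

theorem integral_pow_quadrature {b : ℕ → ℝ} (hb : b 0 = 0) {ω : ℕ → ℝ}
    (hω : ∀ n, ω n = b n ^ 2) {N n : ℕ} (hn : n ≤ N) :
    ∫ x, x ^ n ∂(quadrature b N : Measure ℝ) = jacobiMoment ω n 0 :=
  integral_pow_eq_jacobiMoment (finiteMoments_quadrature b N) fun _ hk =>
    integral_jacobiPoly_quadrature hb hω (hk.trans_le hn)

theorem quadrature_ball_le {b : ℕ → ℝ} (hb : b 0 = 0) {N : ℕ} {x : ℕ → ℝ} (hx : x (N + 1) = 0)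
    (h0 : b 1 * x 1 = 1) (hS : ∀ i, b (i + 2) * x (i + 2) + b (i + 1) * x i = 0) (ε : ℝ) :
    (quadrature b N : Measure ℝ) (Metric.ball 0 ε) ≤
      ENNReal.ofReal (ε ^ 2 * ∑ i ∈ Finset.range (N + 1), x i ^ 2) := by
  rw [← norm_truncate_sq]
  refine spectralMeasure_ball_le _ _ ?_ ε
  -- The hypotheses on `x` say exactly that the matrix sends its truncation to the first basis
  -- vector.
  rw [jacobiMatrix_apply_truncate hb hx]
  congr 1
  ext (_ | i)
  · simp [h0, hb]
  · simpa using hS i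

theorem le_quadrature_singleton_zero {b : ℕ → ℝ} (hb : b 0 = 0) {N : ℕ} {x : ℕ → ℝ}
    (hx : x (N + 1) = 0) (h0 : x 0 = 1) (h1 : x 1 = 0)
    (hS : ∀ i, b (i + 2) * x (i + 2) + b (i + 1) * x i = 0) :
    1 ≤ ENNReal.ofReal (∑ i ∈ Finset.range (N + 1), x i ^ 2) *
      (quadrature b N : Measure ℝ) {0} := by
  have h := le_spectralMeasure_singleton_zero (isSymmetric_jacobiMatrix b (N + 1))
    (truncate (N + 1) (Pi.single 0 1)) (u := truncate (N + 1) x) (by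
      rw [jacobiMatrix_apply_truncate hb hx]
      ext ⟨i, hi⟩
      rcases i with _ | i
      · simp [truncate, h1, hb]
      · simpa [truncate] using hS i)
  rw [norm_truncate_sq, inner_truncate] at h
  simp only [Pi.single_apply, mul_ite, mul_one, mul_zero, Finset.sum_ite_eq', Finset.mem_range,
    Nat.succ_pos, if_true, h0, one_pow, ENNReal.ofReal_one] at h
  exact h

/-! ### Square-summable solutions at energy zero -/

/-- The solution of `b (n + 2) x (n + 2) + b (n + 1) x n = 0` with initial values `u`, `v`. -/
noncomputable def kernelSeq (b : ℕ → ℝ) (u v : ℝ) : ℕ → ℝ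
  | 0 => u
  | 1 => v
  | n + 2 => -(b (n + 1) / b (n + 2)) * kernelSeq b u v n

theorem kernelSeq_rec {b : ℕ → ℝ} (hb : ∀ n, b (n + 1) ≠ 0) (u v : ℝ) (n : ℕ) :
    b (n + 2) * kernelSeq b u v (n + 2) + b (n + 1) * kernelSeq b u v n = 0 := by
  have := hb (n + 1)
  rw [kernelSeq]
  field_simp
  ring

theorem kernelSeq_two_mul (b : ℕ → ℝ) (v : ℝ) (n : ℕ) : kernelSeq b 0 v (2 * n) = 0 := by
  induction n with
  | zero => rfl
  | succ n ih => rw [show 2 * (n + 1) = 2 * n + 2 by ring, kernelSeq, ih, mul_zero]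

theorem kernelSeq_two_mul_add_one (b : ℕ → ℝ) (u : ℝ) (n : ℕ) :
    kernelSeq b u 0 (2 * n + 1) = 0 := by
  induction n with
  | zero => rfl
  | succ n ih => rw [show 2 * (n + 1) + 1 = 2 * n + 1 + 2 by ring, kernelSeq, ih, mul_zero]

/-- Each step multiplies the square by `((n+1)/(n+2))^p`, and `(n+1)(n+3) ≤ (n+2)^2` makes this
compatible with the decay `(n+1)^(-p/2)`. The constant `2 ^ (p/2)` is what `n = 1` requires. -/
theorem kernelSeq_sq_le {b : ℕ → ℝ} {p u v : ℝ} (hp : 0 ≤ p) (hb : ∀ n, b n ^ 2 = (n : ℝ) ^ p)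
    (hu : u ^ 2 ≤ 1) (hv : v ^ 2 ≤ 1) (n : ℕ) :
    kernelSeq b u v n ^ 2 ≤ 2 ^ (p / 2) * (1 / (n + 1 : ℝ)) ^ (p / 2) := by
  have h2 : (1 : ℝ) ≤ 2 ^ (p / 2) := Real.one_le_rpow one_le_two (by positivity)
  induction n using Nat.strong_induction_on with
  | _ n ih =>
    match n with
    | 0 => simpa [kernelSeq] using hu.trans h2
    | 1 =>
      rw [← Real.mul_rpow (by positivity) (by positivity)]
      norm_num [kernelSeq]
      exact abs_le_one_iff_mul_self_le_one.2 (by nlinarith)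
    | n + 2 =>
      have h := ih n (by omega)
      have hsq (k : ℕ) : (k : ℝ) ^ p = ((k : ℝ) ^ 2) ^ (p / 2) := by
        rw [← Real.rpow_natCast, ← Real.rpow_mul (by positivity)]
        congr 1
        push_cast
        ring
      rw [kernelSeq, mul_pow, neg_sq, div_pow, hb, hb, hsq, hsq,
        ← Real.div_rpow (by positivity) (by positivity)]
      refine (mul_le_mul_of_nonneg_left h (by positivity)).trans ?_
      rw [mul_left_comm, ← Real.mul_rpow (by positivity) (by positivity)]
      gcongr
      push_cast
      rw [div_mul_div_comm, div_le_div_iff₀ (by positivity) (by positivity)]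
      nlinarith

theorem exists_sum_kernelSeq_sq_le {b : ℕ → ℝ} {p u v : ℝ} (hp : 2 < p)
    (hb : ∀ n, b n ^ 2 = (n : ℝ) ^ p) (hu : u ^ 2 ≤ 1) (hv : v ^ 2 ≤ 1) :
    ∃ D : ℝ, ∀ N, ∑ i ∈ Finset.range N, kernelSeq b u v i ^ 2 ≤ D := by
  have hs : Summable fun n : ℕ => 2 ^ (p / 2) * (1 / (n + 1 : ℝ)) ^ (p / 2) := by
    apply Summable.mul_left
    have := (summable_nat_add_iff 1).2 (Real.summable_one_div_nat_rpow.2 (by linarith : 1 < p / 2))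
    refine this.congr fun n => ?_
    rw [Real.div_rpow zero_le_one (by positivity), Real.one_rpow]
    push_cast
    rfl
  exact ⟨_, fun N => (Finset.sum_le_sum fun i _ =>
    kernelSeq_sq_le (by linarith) hb hu hv i).trans
      (hs.sum_le_tsum _ fun i _ => by positivity)⟩

/-! ### From quadrature limits to solutions of the moment problem -/

/-- Averaging `ν` with its reflection keeps the moments, since the odd ones vanish, and keeps the
mass at `0`, the fixed point of the reflection. -/
theorem exists_isSymmetricWithJacobi_of_moments {ω : ℕ → ℝ} {b : ℕ → ℝ} (hb : b 0 = 0)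
    (hω : ∀ n, ω n = b n ^ 2) {ν : Measure ℝ} [IsProbabilityMeasure ν] (hν : FiniteMoments ν)
    (hm : ∀ k : ℕ, ∫ x, x ^ k ∂ν = jacobiMoment ω k 0) :
    ∃ μ : Measure ℝ, IsSymmetricWithJacobi μ ω ∧ μ {0} = ν {0} := by
  have hneg (k : ℕ) : Integrable (fun x : ℝ => x ^ k) (ν.map Neg.neg) := by
    rw [integrable_map_measure (by fun_prop) (by fun_prop)]
    refine ((hν k).const_mul ((-1) ^ k)).congr (.of_forall fun x => ?_)
    simp [← mul_pow]
  have h2 : (2⁻¹ : ENNReal) ≠ ⊤ := by simp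
  set μ : Measure ℝ := (2⁻¹ : ENNReal) • (ν + ν.map Neg.neg) with hμ
  have hfin : FiniteMoments μ := fun k => ((hν k).add_measure (hneg k)).smul_measure h2
  have hprob : IsProbabilityMeasure μ := by
    refine ⟨?_⟩
    rw [hμ, Measure.smul_apply, Measure.add_apply, Measure.map_apply measurable_neg .univ]
    simp only [Set.preimage_univ, measure_univ, smul_eq_mul, one_add_one_eq_two]
    exact ENNReal.inv_mul_cancel two_ne_zero ENNReal.ofNat_ne_top
  have hmom (k : ℕ) : ∫ x, x ^ k ∂μ = jacobiMoment ω k 0 := by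
    have h3 : ∫ x, x ^ k ∂(ν.map Neg.neg) = (-1) ^ k * jacobiMoment ω k 0 := by
      rw [integral_map (by fun_prop) (by fun_prop), ← hm, ← integral_const_mul]
      congr 1 with x
      rw [← mul_pow, neg_one_mul]
    rw [hμ, integral_smul_measure, integral_add_measure (hν k) (hneg k), h3, hm]
    rcases k.even_or_odd with h | h
    · rw [h.neg_one_pow]
      simp only [ENNReal.toReal_inv, ENNReal.toReal_ofNat, smul_eq_mul]
      ring
    · rw [jacobiMoment_eq_zero_of_odd ω k 0 (by simpa using h)]
      simp
  have hinv : μ.IsNegInvariant := by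
    refine ⟨?_⟩
    have h3 : (ν.map Neg.neg).map Neg.neg = ν := by
      rw [Measure.map_map measurable_neg measurable_neg, neg_comp_neg, Measure.map_id]
    rw [Measure.neg, hμ, Measure.map_smul, Measure.map_add _ _ measurable_neg, h3, add_comm]
  refine ⟨μ, isSymmetricWithJacobi_iff.2 ⟨hprob, hinv, hfin, fun n => ?_⟩, ?_⟩
  -- A quadrature measure of high enough order has the same moments up to the degree of `P_{n+1}`,
  -- and integrates this polynomial to `0`.
  · rw [integral_eval_eq_of_moments hfin (finiteMoments_quadrature b (n + 1)) _ fun k hk => ?_]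
    · exact integral_jacobiPoly_quadrature hb hω n.lt_succ_self
    · rw [(jacobiPoly_monic_natDegree ω (n + 1)).2] at hk
      rw [hmom, integral_pow_quadrature hb hω hk]
  · rw [hμ, Measure.smul_apply, Measure.add_apply, Measure.map_apply measurable_neg (by simp)]
    simp only [Set.neg_preimage, Set.neg_singleton, neg_zero, smul_eq_mul, ← two_mul]
    rw [← mul_assoc, ENNReal.inv_mul_cancel two_ne_zero ENNReal.ofNat_ne_top, one_mul]

theorem exists_limit_quadrature {b : ℕ → ℝ} (hb : b 0 = 0) {ω : ℕ → ℝ} (hω : ∀ n, ω n = b n ^ 2)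
    {N : ℕ → ℕ} (hN : Tendsto N atTop atTop) :
    ∃ (ν : ProbabilityMeasure ℝ) (φ : ℕ → ℕ),
      Tendsto (fun n => quadrature b (N (φ n))) atTop (𝓝 ν) ∧ FiniteMoments ν ∧
        ∀ k, ∫ x, x ^ k ∂(ν : Measure ℝ) = jacobiMoment ω k 0 := by
  obtain ⟨ν, φ, -, h1, h2, h3⟩ := exists_tendsto_subseq_of_moments
    (μ := fun n => quadrature b (N n)) (m := fun k => jacobiMoment ω k 0)
    (fun n => finiteMoments_quadrature b _) fun k =>
      (hN.eventually_ge_atTop k).mono fun n hn => integral_pow_quadrature hb hω hn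
  exact ⟨ν, φ, h1, h2, h3⟩

theorem exists_isSymmetricWithJacobi {b : ℕ → ℝ} (hb : b 0 = 0) {ω : ℕ → ℝ}
    (hω : ∀ n, ω n = b n ^ 2) : ∃ μ, IsSymmetricWithJacobi μ ω := by
  obtain ⟨ν, -, -, h2, h3⟩ := exists_limit_quadrature hb hω tendsto_id
  obtain ⟨μ, hμ, -⟩ := exists_isSymmetricWithJacobi_of_moments hb hω h2 h3
  exact ⟨μ, hμ⟩

theorem exists_isSymmetricWithJacobi_singleton_zero_eq_zero {b : ℕ → ℝ} (hb : b 0 = 0)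
    (hb1 : ∀ n, b (n + 1) ≠ 0) {ω : ℕ → ℝ} (hω : ∀ n, ω n = b n ^ 2) {D : ℝ}
    (hD : ∀ N, ∑ i ∈ Finset.range N, kernelSeq b 0 (b 1)⁻¹ i ^ 2 ≤ D) :
    ∃ μ, IsSymmetricWithJacobi μ ω ∧ μ {0} = 0 := by
  obtain ⟨ν, φ, h1, h2, h3⟩ := exists_limit_quadrature hb hω
    -- Even matrix size `2n + 2`: the solution starting from `0` vanishes at even indices, hence at
    -- the cutoff.
    (N := fun n => 2 * n + 1) (tendsto_atTop_mono (fun n => show n ≤ _ by omega) tendsto_id)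
  obtain ⟨μ, hμ, hμ0⟩ := exists_isSymmetricWithJacobi_of_moments hb hω h2 h3
  refine ⟨μ, hμ, hμ0.trans ?_⟩
  have hle (ε : ℝ) (hε : 0 < ε) : (ν : Measure ℝ) {0} ≤ ENNReal.ofReal (ε ^ 2 * D) := by
    refine (measure_mono (Set.singleton_subset_iff.2 (Metric.mem_ball_self hε))).trans ?_
    refine (ProbabilityMeasure.le_liminf_measure_open_of_tendsto h1 Metric.isOpen_ball).trans ?_
    refine liminf_le_of_frequently_le' (Frequently.of_forall fun n => ?_)
    refine (quadrature_ball_le hb (x := kernelSeq b 0 (b 1)⁻¹)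
      (kernelSeq_two_mul b _ (φ n + 1)) (mul_inv_cancel₀ (hb1 0))
      (kernelSeq_rec hb1 _ _) ε).trans ?_
    exact ENNReal.ofReal_le_ofReal (mul_le_mul_of_nonneg_left (hD _) (sq_nonneg ε))
  have hlim : Tendsto (fun ε : ℝ => ENNReal.ofReal (ε ^ 2 * D)) (𝓝[>] 0) (𝓝 0) := by
    have : Continuous fun ε : ℝ => ENNReal.ofReal (ε ^ 2 * D) :=
      ENNReal.continuous_ofReal.comp (by fun_prop)
    exact (this.tendsto' 0 0 (by simp)).mono_left nhdsWithin_le_nhds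
  exact le_antisymm (ge_of_tendsto hlim (eventually_mem_nhdsWithin.mono hle)) zero_le

theorem exists_isSymmetricWithJacobi_singleton_zero_ne_zero {b : ℕ → ℝ} (hb : b 0 = 0)
    (hb1 : ∀ n, b (n + 1) ≠ 0) {ω : ℕ → ℝ} (hω : ∀ n, ω n = b n ^ 2) {D : ℝ}
    (hD : ∀ N, ∑ i ∈ Finset.range N, kernelSeq b 1 0 i ^ 2 ≤ D) :
    ∃ μ, IsSymmetricWithJacobi μ ω ∧ μ {0} ≠ 0 := by
  obtain ⟨ν, φ, h1, h2, h3⟩ := exists_limit_quadrature hb hω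
    -- Odd matrix size `2n + 1`: the solution with `x 1 = 0` vanishes at odd indices, so its
    -- truncation lies in the kernel and gives an atom of mass at least `1 / D`.
    (N := fun n => 2 * n) (tendsto_atTop_mono (fun n => show n ≤ _ by omega) tendsto_id)
  obtain ⟨μ, hμ, hμ0⟩ := exists_isSymmetricWithJacobi_of_moments hb hω h2 h3
  refine ⟨μ, hμ, ?_⟩
  rw [hμ0]
  have hle (n : ℕ) : (ENNReal.ofReal D)⁻¹ ≤ (quadrature b (2 * φ n) : Measure ℝ) {0} := by
    rw [ENNReal.inv_le_iff_le_mul (fun h => absurd h (measure_ne_top _ _))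
      (fun h => absurd h ENNReal.ofReal_ne_top)]
    refine (le_quadrature_singleton_zero hb (x := kernelSeq b 1 0)
      (kernelSeq_two_mul_add_one b _ (φ n)) rfl rfl (kernelSeq_rec hb1 _ _)).trans ?_
    gcongr
    exact hD _
  -- Weak limits can only gain mass on closed sets, so the atom persists.
  have hlim : (ENNReal.ofReal D)⁻¹ ≤ (ν : Measure ℝ) {0} :=
    (le_limsup_of_frequently_le' (Frequently.of_forall hle)).trans
      (ProbabilityMeasure.limsup_measure_closed_le_of_tendsto h1 isClosed_singleton)
  exact ((ENNReal.inv_pos.2 ENNReal.ofReal_ne_top).trans_le hlim).ne'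

/-! ### The dichotomy at `p = 2` -/

theorem IsSymmetricWithJacobi.isMomentDeterminate {ω : ℕ → ℝ} (h0 : ∀ k, 0 ≤ ω k)
    (h : ∀ k, ω k ≤ (k : ℝ) ^ 2) {μ : Measure ℝ} (hμ : IsSymmetricWithJacobi μ ω) :
    IsMomentDeterminate μ := by
  have := hμ.isProbabilityMeasure
  refine isMomentDeterminate_of_moment_bound hμ.hasJacobiSequences.1 fun n => ?_
  rw [hμ.integral_pow]
  exact (jacobiMoment_bound h0 h n 0).2

theorem IsSymmetricWithJacobi.eq_of_isMomentDeterminate {ω : ℕ → ℝ} {μ ν : Measure ℝ}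
    (hμ : IsSymmetricWithJacobi μ ω) (hν : IsSymmetricWithJacobi ν ω)
    (h : IsMomentDeterminate μ) : ν = μ :=
  h ν hν.isProbabilityMeasure hν.hasJacobiSequences.1 fun n => by
    rw [hν.integral_pow, hμ.integral_pow]

theorem exists_ne_isSymmetricWithJacobi_rpow {p : ℝ} (hp : 2 < p) :
    ∃ μ ν : Measure ℝ, μ ≠ ν ∧ IsSymmetricWithJacobi μ (fun n : ℕ => (n : ℝ) ^ p) ∧
      IsSymmetricWithJacobi ν (fun n : ℕ => (n : ℝ) ^ p) := by
  set b : ℕ → ℝ := fun n => √((n : ℝ) ^ p) with hbdef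
  have hsq (n : ℕ) : b n ^ 2 = (n : ℝ) ^ p := Real.sq_sqrt (by positivity)
  have hb : b 0 = 0 := by simp [hbdef, Real.zero_rpow (by linarith : p ≠ 0)]
  have hb1 (n : ℕ) : b (n + 1) ≠ 0 := (Real.sqrt_pos.2 (by positivity)).ne'
  obtain ⟨D, hD⟩ := exists_sum_kernelSeq_sq_le hp hsq (u := 0) (v := (b 1)⁻¹) (by simp)
    (by simp [hbdef])
  obtain ⟨E, hE⟩ := exists_sum_kernelSeq_sq_le hp hsq (u := 1) (v := 0) (by simp) (by simp)
  obtain ⟨μ, hμ, hμ0⟩ := exists_isSymmetricWithJacobi_singleton_zero_eq_zero hb hb1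
    (fun n => (hsq n).symm) hD
  obtain ⟨ν, hν, hν0⟩ := exists_isSymmetricWithJacobi_singleton_zero_ne_zero hb hb1
    (fun n => (hsq n).symm) hE
  exact ⟨μ, ν, fun h => hν0 (h ▸ hμ0), hμ, hν⟩

theorem exists_isSymmetricWithJacobi_rpow {p : ℝ} (hp : 0 < p) :
    ∃ μ : Measure ℝ, IsSymmetricWithJacobi μ (fun n : ℕ => (n : ℝ) ^ p) :=
  exists_isSymmetricWithJacobi (b := fun n : ℕ => √((n : ℝ) ^ p))
    (by simp [Real.zero_rpow hp.ne']) fun n => (Real.sq_sqrt (by positivity)).symm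

theorem isMomentDeterminate_of_jacobi_rpow {p : ℝ} (hp0 : 0 < p) (hp : p ≤ 2) {μ : Measure ℝ}
    (hμ : IsSymmetricWithJacobi μ (fun n : ℕ => (n : ℝ) ^ p)) : IsMomentDeterminate μ := by
  refine hμ.isMomentDeterminate (fun k => by positivity) fun k => ?_
  rcases k.eq_zero_or_pos with rfl | hk
  · simp [Real.zero_rpow hp0.ne']
  · rw [← Real.rpow_two]
    exact Real.rpow_le_rpow_of_exponent_le (by exact_mod_cast hk) hp

theorem mainTheorem3 :
    (∀ p : ℝ, 0 < p →
      (∃ μ : Measure ℝ, IsSymmetricWithJacobi μ (fun n : ℕ => (n : ℝ) ^ p)) ∧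
      (∀ μ : Measure ℝ, IsSymmetricWithJacobi μ (fun n : ℕ => (n : ℝ) ^ p) →
        (IsMomentDeterminate μ ↔ p ≤ 2)) ∧
      ((∃! μ : Measure ℝ, IsSymmetricWithJacobi μ (fun n : ℕ => (n : ℝ) ^ p)) ↔ p ≤ 2)) ∧
    IsSymmetricWithJacobi hyperbolicSecant (fun n : ℕ => (n : ℝ) ^ (2 : ℝ)) ∧
    IsMomentDeterminate hyperbolicSecant := by
  have hsech := isSymmetricWithJacobi_hyperbolicSecant
    (ω := fun n : ℕ => (n : ℝ) ^ (2 : ℝ)) fun n => Real.rpow_two _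
  refine ⟨fun p hp => ⟨exists_isSymmetricWithJacobi_rpow hp, fun μ hμ =>
    ⟨fun hdet => ?_, fun h => isMomentDeterminate_of_jacobi_rpow hp h hμ⟩,
    fun hu => ?_, fun h => ?_⟩, hsech, isMomentDeterminate_of_jacobi_rpow two_pos le_rfl hsech⟩
  -- All solutions share their moments, so determinacy of any one of them would make the two
  -- solutions for `p > 2` coincide.
  · by_contra! h
    obtain ⟨ν₁, ν₂, hne, h1, h2⟩ := exists_ne_isSymmetricWithJacobi_rpow h
    exact hne ((hμ.eq_of_isMomentDeterminate h1 hdet).trans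
      (hμ.eq_of_isMomentDeterminate h2 hdet).symm)
  · by_contra! h
    obtain ⟨ν₁, ν₂, hne, h1, h2⟩ := exists_ne_isSymmetricWithJacobi_rpow h
    exact hne (hu.unique h1 h2)
  · obtain ⟨μ, hμ⟩ := exists_isSymmetricWithJacobi_rpow hp
    exact ⟨μ, hμ, fun ν hν =>
      hμ.eq_of_isMomentDeterminate hν (isMomentDeterminate_of_jacobi_rpow hp h hμ)⟩
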